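/- A *$2$-tree* on the vertex set $[n]=\{1,\dots,n\}$ is a $2$-dimensional simplicial complex $T$ on $[n]$ with complete $1$-skeleton such that $H_1(T;\mathbb{Q}) = H_2(T;\mathbb{Q}) = 0$. Let $\mathcal{T}(n)$ be the (finite) set of all $2$-trees on $[n]$. For $T\in\mathcal{T}(n)$ the group $H_1(T)=H_1(T;\mathbb{Z})$ is finite; the determinantal (torsion-squared) measure on $\mathcal{T}(n)$ is the probability measure for which the probability of $T$ is proportional to $|H_1(T)|^2$, i.e. $\mathbb{P}(T)=|H_1(T)|^2\big/\sum_{S\in\mathcal{T}(n)}|H_1(S)|^2$. **Theorem.** If $T$ is sampled from $\mathcal{T}(n)$ according to the determinantal measure, then $H_1(T)\neq 0$ with probability at least $1-\exp(-\Omega(n^2))$. That is, there is a constant $c>0$ such that for all sufficiently large $n$, $$\mathbb{P}\big[H_1(T)\neq 0\big]\;\ge\; 1-\exp(-c\,n^2).$$ -/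

import Mathlib

open scoped ENNReal

noncomputable section

namespace SimplicialHomology

variable {ι : Type*}

/-- The `k`-dimensional faces of `K`, that is, its faces with `k + 1` vertices. -/
def Face (K : AbstractSimplicialComplex ι) (k : ℕ) : Type _ :=
  {s : Finset ι // s ∈ K ∧ s.card = k + 1}

instance [Finite ι] (K : AbstractSimplicialComplex ι) (k : ℕ) : Fintype (Face K k) :=
  haveI : Finite (Face K k) := inferInstanceAs (Finite {s : Finset ι // s ∈ K ∧ s.card = k + 1})
  Fintype.ofFinite _

/-- Simplicial `k`-chains of the finite complex `K` with coefficients in `R`: the free `R`-module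
on the `k`-dimensional faces, each of them oriented by the order of the vertices. The chain
`∑ s, c s • [s]` is given by its coefficients `c s`. -/
abbrev Chain (K : AbstractSimplicialComplex ι) (R : Type*) (k : ℕ) : Type _ :=
  Face K k → R

variable [LinearOrder ι] [Finite ι]

/-- The position of the vertex `v` in the increasing enumeration of `s`, counted from `0`. -/
def position (s : Finset ι) (v : ι) : ℕ := (s.filter (· < v)).card

/-- The matrix of the simplicial boundary map
`∂ [v₀ < ⋯ < v₍ₖ₊₁₎] = ∑ i, (-1) ^ i [v₀ < ⋯ < v̂ᵢ < ⋯ < v₍ₖ₊₁₎]`: its entry at `(t, s)` is the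
coefficient of `[t]` in `∂ [s]`. -/
def boundaryMatrix (K : AbstractSimplicialComplex ι) (R : Type*) [CommRing R] (k : ℕ) :
    Matrix (Face K k) (Face K (k + 1)) R :=
  fun t s => ∑ v ∈ s.1, if s.1.erase v = t.1 then (-1 : R) ^ position s.1 v else 0

/-- The simplicial boundary map from `(k + 1)`-chains to `k`-chains. -/
def boundary (K : AbstractSimplicialComplex ι) (R : Type*) [CommRing R] (k : ℕ) :
    Chain K R (k + 1) →ₗ[R] Chain K R k :=
  (boundaryMatrix K R k).mulVecLin

/-- Simplicial `k`-cycles; every `0`-chain is a cycle. -/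
def cycles (K : AbstractSimplicialComplex ι) (R : Type*) [CommRing R] :
    (k : ℕ) → Submodule R (Chain K R k)
  | 0 => ⊤
  | k + 1 => LinearMap.ker (boundary K R k)

/-- Simplicial `k`-boundaries. -/
def boundaries (K : AbstractSimplicialComplex ι) (R : Type*) [CommRing R] (k : ℕ) :
    Submodule R (Chain K R k) :=
  LinearMap.range (boundary K R k)

/-- Simplicial homology `H_k(K; R)`: cycles modulo boundaries. -/
abbrev Homology (K : AbstractSimplicialComplex ι) (R : Type*) [CommRing R] (k : ℕ) : Type _ :=
  cycles K R k ⧸ (boundaries K R k).submoduleOf (cycles K R k)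

end SimplicialHomology

open SimplicialHomology

/-- A simplicial complex on the vertex set `Fin n` is a `2`-tree if it is `2`-dimensional, its
`1`-skeleton is the complete graph, and `H₁(K; ℚ) = H₂(K; ℚ) = 0`. -/
structure IsTwoTree {n : ℕ} (K : AbstractSimplicialComplex (Fin n)) : Prop where
  card_le : ∀ s ∈ K, s.card ≤ 3
  exists_triangle : ∃ s ∈ K, s.card = 3
  complete : ∀ u v : Fin n, u ≠ v → {u, v} ∈ K
  homology_one : Subsingleton (Homology K ℚ 1)
  homology_two : Subsingleton (Homology K ℚ 2)

/-- The set `𝒯(n)` of all `2`-trees on the (labelled) vertex set `Fin n`. -/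
abbrev TwoTree (n : ℕ) : Type :=
  {K : AbstractSimplicialComplex (Fin n) // IsTwoTree K}

/-- Every set of `2`-trees is an event. -/
instance (n : ℕ) : MeasurableSpace (TwoTree n) := ⊤

/-- The order of the group `H₁(T) = H₁(T; ℤ)`, which is finite for a `2`-tree. -/
def torsionOrder {n : ℕ} (T : TwoTree n) : ℕ := Nat.card (Homology T.1 ℤ 1)

/-- The weight `|H₁(T)|²`. -/
def torsionWeight {n : ℕ} (T : TwoTree n) : ℝ≥0∞ := (torsionOrder T : ℝ≥0∞) ^ 2

/-- The determinantal (torsion-squared) measure on `𝒯(n)`: the probability of `T` is proportional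
to `|H₁(T)|²`, that is, `ℙ(T) = |H₁(T)|² / ∑ S ∈ 𝒯(n), |H₁(S)|²`. -/
def determinantalMeasure (n : ℕ) : MeasureTheory.Measure (TwoTree n) :=
  MeasureTheory.Measure.sum fun T : TwoTree n =>
    (torsionWeight T / ∑' S : TwoTree n, torsionWeight S) • MeasureTheory.Measure.dirac T

end

/-!
The `2`-trees are so few, compared with their total weight, that those without torsion are rare.
Fix a vertex `o`, let `m = C(n - 1, 2)` be the number of edges avoiding `o`, and let `M` be the
boundary matrix from all triangles to these edges.

The total weight is given by Kalai's theorem. A `1`-cycle of the complete graph is determined by its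
coefficients at the edges avoiding `o`, and these are arbitrary (`cyclesEquiv`), so `H₁` of a
complex with complete `1`-skeleton is the cokernel of the columns of `M` at its triangles
(`homologyOneEquiv`). Hence a family of `m` columns has nonzero determinant exactly when it
enumerates the triangles of a `2`-tree `T`, and then the determinant is `± |H₁(T)|`
(`torsionOrder_eq_natAbs_det`, `mem_range_triangleFamily`). By Cauchy–Binet
(`factorial_mul_det_mul`), `∑ |H₁(T)|² = det (M Mᵀ)`. The up- and down-Laplacians of a simplex
add up to the scalar `n` (`sum_incidence_add_sum_incidence`), so `M Mᵀ = n - DᵀD` with `D` the vertex–edge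
boundary matrix, while `n - D Dᵀ` is the identity plus the all-ones matrix; comparing the
characteristic polynomials of `DᵀD` and `D Dᵀ` gives `n ^ (n - 2) * det (M Mᵀ) = n ^ m`
(`card_pow_mul_det_reducedBoundary`, `card_pow_mul_sum_torsionOrder_sq`).

A `2`-tree without torsion has weight `1`, and a `2`-tree has exactly `m` of the `C(n, 3) = m n / 3`
triangles, so there are at most `C(n, 3) ^ m / m! ≤ (e n / 3) ^ m` of them
(`factorial_mul_card_twoTree_le`, `choose_three_pow_le`). The probability of vanishing torsion is
therefore at most `(e / 3) ^ m * n ^ (n - 2)`, which is `exp (-Ω(n²))` because `e < 3`.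
-/

namespace SimplicialHomology

open Finset Matrix MeasureTheory

/-! ### Incidence numbers and the Laplacian of the simplex -/

section Incidence

variable {ι : Type*} [LinearOrder ι]

/-- The coefficient of `[t]` in `∂ [s]`, for arbitrary finite sets `t` and `s`. It vanishes unless
`t` arises from `s` by deleting one vertex; the empty set counts as a face of every singleton. -/
def incidence (R : Type*) [CommRing R] (t s : Finset ι) : R :=
  ∑ v ∈ s, if s.erase v = t then (-1 : R) ^ position s v else 0

theorem incidence_erase (R : Type*) [CommRing R] {s : Finset ι} {v : ι} (hv : v ∈ s) :
    incidence R (s.erase v) s = (-1) ^ position s v := by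
  rw [incidence, Finset.sum_eq_single_of_mem v hv, if_pos rfl]
  intro w hw hwv
  rw [if_neg]
  intro h
  have : v ∈ s.erase w := Finset.mem_erase.2 ⟨hwv.symm, hv⟩
  rw [h] at this
  simp at this

theorem exists_erase_eq_of_incidence_ne_zero {R : Type*} [CommRing R] {t s : Finset ι}
    (h : incidence R t s ≠ 0) : ∃ v ∈ s, s.erase v = t := by
  obtain ⟨v, hv, hvt⟩ := Finset.exists_ne_zero_of_sum_ne_zero h
  exact ⟨v, hv, by by_contra h; simp [h] at hvt⟩

theorem card_eq_of_incidence_ne_zero {R : Type*} [CommRing R] {t s : Finset ι}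
    (h : incidence R t s ≠ 0) : s.card = t.card + 1 := by
  obtain ⟨v, hv, rfl⟩ := exists_erase_eq_of_incidence_ne_zero h
  rw [Finset.card_erase_add_one hv]

theorem incidence_map {R S : Type*} [CommRing R] [CommRing S] (φ : R →+* S) (t s : Finset ι) :
    φ (incidence R t s) = incidence S t s := by
  simp only [incidence, map_sum]
  refine Finset.sum_congr rfl fun v _ => ?_
  split_ifs <;> simp

theorem incidence_singleton_eq_zero_of_notMem (R : Type*) [CommRing R] {v : ι} {e : Finset ι}
    (h : v ∉ e) : incidence R {v} e = 0 := by
  by_contra h0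
  obtain ⟨w, -, hw⟩ := exists_erase_eq_of_incidence_ne_zero h0
  exact h (mem_of_mem_erase (hw ▸ mem_singleton_self v))

theorem incidence_singleton_pair_mul_self (R : Type*) [CommRing R] {v w : ι} (h : v ≠ w) :
    incidence R {v} {v, w} * incidence R {v} {v, w} = 1 := by
  have := incidence_erase R (s := {v, w}) (v := w) (by simp)
  rw [show ({v, w} : Finset ι).erase w = {v} by ext; simp; grind] at this
  rw [this, ← pow_add, Even.neg_one_pow ⟨_, rfl⟩]

theorem position_erase_self (s : Finset ι) (v : ι) : position (s.erase v) v = position s v := by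
  unfold position
  congr 1
  ext x
  simp only [mem_filter, mem_erase]
  exact ⟨fun h => ⟨h.1.2, h.2⟩, fun h => ⟨⟨h.2.ne, h.1⟩, h.2⟩⟩

theorem position_insert_self (s : Finset ι) (v : ι) : position (insert v s) v = position s v := by
  rw [← position_erase_self, ← position_erase_self s]
  simp

theorem position_insert_of_lt {s : Finset ι} {a b : ι} (ha : a ∉ s) (h : a < b) :
    position (insert a s) b = position s b + 1 := by
  unfold position
  rw [Finset.filter_insert, if_pos h, Finset.card_insert_of_notMem (by simp [ha])]

theorem position_insert_of_gt {s : Finset ι} {a b : ι} (h : b < a) :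
    position (insert a s) b = position s b := by
  unfold position
  rw [Finset.filter_insert, if_neg h.asymm]

/-- Two vertices `a` and `b` are added to `s` with opposite signs in the two possible orders. -/
theorem sign_insert_insert (R : Type*) [CommRing R] {s : Finset ι} {a b : ι} (ha : a ∉ s)
    (hb : b ∉ s) (hab : a ≠ b) :
    (-1 : R) ^ position s a * (-1) ^ position (insert a s) b =
      -((-1) ^ position s b * (-1) ^ position (insert b s) a) := by
  rcases lt_or_gt_of_ne hab with h | h
  · rw [position_insert_of_lt ha h, position_insert_of_gt h]
    ring
  · rw [position_insert_of_lt hb h, position_insert_of_gt h]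
    ring

theorem sign_erase_erase (R : Type*) [CommRing R] {t : Finset ι} {a b : ι} (ha : a ∈ t)
    (hb : b ∈ t) (hab : a ≠ b) :
    (-1 : R) ^ position t a * (-1) ^ position (t.erase a) b =
      -((-1) ^ position t b * (-1) ^ position (t.erase b) a) := by
  have e1 : insert a ((t.erase a).erase b) = t.erase b := by
    rw [erase_right_comm, insert_erase (by simp [ha, hab])]
  have e2 : insert b ((t.erase a).erase b) = t.erase a := insert_erase (by simp [hb, hab.symm])
  have := sign_insert_insert R (s := (t.erase a).erase b) (by simp) (by simp) hab
  rw [← position_insert_self _ a, ← position_insert_self _ b, e1, e2, position_erase_self,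
    position_erase_self, position_insert_self, position_erase_self] at this
  linear_combination this

theorem sign_erase_insert (R : Type*) [CommRing R] {e : Finset ι} {a b : ι} (ha : a ∉ e)
    (hb : b ∈ e) :
    (-1 : R) ^ position (e.erase b) a * (-1) ^ position e b =
      -((-1) ^ position e a * (-1) ^ position (insert a e) b) := by
  have hab : a ≠ b := by rintro rfl; exact ha hb
  have hsq : ∀ k : ℕ, (-1 : R) ^ k * (-1) ^ k = 1 := fun k => by
    rw [← pow_add, Even.neg_one_pow ⟨k, rfl⟩]
  have := sign_erase_erase R (mem_insert_self a e) (mem_insert_of_mem hb) hab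
  rw [erase_insert ha, erase_insert_of_ne hab, position_insert_self, position_insert_self] at this
  linear_combination ((-1 : R) ^ position (insert a e) b * (-1) ^ position e b) * this
    - (-1 : R) ^ position (insert a e) b * (-1) ^ position e a * hsq (position e b)
    - (-1 : R) ^ position e b * (-1) ^ position (e.erase b) a * hsq (position (insert a e) b)

variable [Fintype ι]

/-- Summing over the facets `r` of `s` is summing over the deleted vertex. -/
theorem sum_mul_incidence (R : Type*) [CommRing R] (s : Finset ι) (g : Finset ι → R) :
    ∑ r, g r * incidence R r s = ∑ v ∈ s, g (s.erase v) * (-1) ^ position s v := by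
  simp only [incidence, Finset.mul_sum, mul_ite, mul_zero]
  rw [Finset.sum_comm]
  simp

/-- Summing over the cofaces `t` of `s` is summing over the added vertex. -/
theorem sum_incidence_mul (R : Type*) [CommRing R] (s : Finset ι) (g : Finset ι → R) :
    ∑ t, incidence R s t * g t = ∑ v ∈ sᶜ, (-1) ^ position s v * g (insert v s) := by
  symm
  refine Finset.sum_of_injOn (fun v => insert v s) ?_ (fun _ _ => Finset.mem_coe.2 (mem_univ _))
    ?_ ?_
  · intro v hv w hw h
    simp only [coe_compl, Set.mem_compl_iff, mem_coe] at hv hw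
    have : v ∈ insert w s := by
      have h' : insert v s = insert w s := h
      rw [← h']; exact mem_insert_self _ _
    exact (mem_insert.1 this).resolve_right hv
  · intro t _ ht
    by_contra h
    obtain ⟨v, hv, rfl⟩ := exists_erase_eq_of_incidence_ne_zero (left_ne_zero_of_mul h)
    exact ht ⟨v, by simp, by simp [hv]⟩
  · intro v hv
    have hv' : v ∉ s := by simpa using hv
    have := incidence_erase R (mem_insert_self v s)
    rw [erase_insert hv', position_insert_self] at this
    rw [this]

/-- The boundary of a boundary vanishes. -/
theorem sum_incidence_mul_incidence (R : Type*) [CommRing R] (r t : Finset ι) :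
    ∑ s, incidence R r s * incidence R s t = 0 := by
  rw [sum_mul_incidence]
  simp only [incidence, Finset.sum_mul, ite_mul, zero_mul]
  rw [Finset.sum_sigma']
  refine Finset.sum_involution (fun x _ => ⟨x.2, x.1⟩) ?_ ?_ ?_ ?_
  · rintro ⟨a, b⟩ h
    simp only [mem_sigma, mem_erase] at h
    obtain ⟨ha, hba, hb⟩ := h
    rw [Finset.erase_right_comm (a := b) (b := a)]
    split_ifs with hr
    · have := sign_erase_erase R ha hb hba.symm
      linear_combination this
    · simp
  · rintro ⟨a, b⟩ h _ h'
    simp only [mem_sigma, mem_erase] at h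
    simp only [Sigma.mk.injEq] at h'
    exact h.2.1 h'.1
  · rintro ⟨a, b⟩ h
    simp only [mem_sigma, mem_erase] at h ⊢
    exact ⟨h.2.2, h.2.1.symm, h.1⟩
  · rintro ⟨a, b⟩ _
    rfl

/-- The up-Laplacian and the down-Laplacian of the full simplex add up to a scalar matrix. -/
theorem sum_incidence_add_sum_incidence (R : Type*) [CommRing R] (e f : Finset ι) :
    ∑ t, incidence R e t * incidence R f t + ∑ r, incidence R r e * incidence R r f =
      if e = f then (Fintype.card ι : R) else 0 := by
  have hsq : ∀ k : ℕ, (-1 : R) ^ k * (-1) ^ k = 1 := fun k => by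
    rw [← pow_add, Even.neg_one_pow ⟨k, rfl⟩]
  -- Adding `a` and deleting `b` is opposite to deleting `b` and adding `a`, if `a ≠ b`; the terms
  -- with `a = b` contribute `1` for each vertex outside `e` and for each vertex of `e`.
  rw [sum_incidence_mul]
  have h1 : ∀ a ∈ eᶜ, (-1 : R) ^ position e a * incidence R f (insert a e) =
      (if e = f then 1 else 0) + ∑ b ∈ e, if insert a (e.erase b) = f then
        (-1 : R) ^ position e a * (-1) ^ position (insert a e) b else 0 := by
    intro a ha
    have ha' : a ∉ e := by simpa using ha
    rw [incidence, sum_insert ha', erase_insert ha', position_insert_self, mul_add, mul_ite, hsq,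
      mul_zero, mul_sum]
    congr 1
    refine sum_congr rfl fun b hb => ?_
    rw [erase_insert_of_ne (by rintro rfl; exact ha' hb), mul_ite, mul_zero]
  have h2 : ∑ r, incidence R r e * incidence R r f =
      ∑ b ∈ e, ((if e = f then 1 else 0) - ∑ a ∈ eᶜ, if insert a (e.erase b) = f then
        (-1 : R) ^ position e a * (-1) ^ position (insert a e) b else 0) := by
    simp_rw [mul_comm (incidence R _ e)]
    rw [sum_mul_incidence]
    refine sum_congr rfl fun b hb => ?_
    have key := sum_incidence_mul R (e.erase b) (fun t => if t = f then 1 else 0)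
    simp only [mul_ite, mul_one, mul_zero, sum_ite_eq', mem_univ, if_true] at key
    rw [key, compl_erase, sum_insert (by simpa using hb), insert_erase hb, add_mul, sum_mul,
      position_erase_self, ite_mul, zero_mul, hsq, sub_eq_add_neg, ← sum_neg_distrib]
    congr 1
    refine sum_congr rfl fun a ha => ?_
    have ha' : a ∉ e := by simpa using ha
    split_ifs with h
    · exact sign_erase_insert R ha' hb
    · simp
  rw [sum_congr rfl h1, h2, sum_add_distrib, sum_sub_distrib, sum_comm (s := e)]
  simp only [sum_const, nsmul_eq_mul, card_compl]
  split_ifs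
  · rw [Nat.cast_sub (card_le_univ e)]
    ring
  · simp

end Incidence

/-! ### The Cauchy–Binet formula -/

section CauchyBinet

variable {m n R : Type*} [Fintype m] [DecidableEq m] [Fintype n] [CommRing R]

/-- The **Cauchy–Binet formula**, as a sum over all families of columns. Families with a repetition
contribute nothing, and each `m`-subset of columns is enumerated `m!` times. -/
theorem factorial_mul_det_mul (A : Matrix m n R) (B : Matrix n m R) :
    ((Fintype.card m).factorial : R) * (A * B).det =
      ∑ f : m → n, (A.submatrix id f).det * (B.submatrix f id).det := by
  classical
  have h1 : (A * B).det = ∑ f : m → n, (A.submatrix id f).det * ∏ i, B (f i) i := by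
    simp only [det_apply', mul_apply, prod_univ_sum, Fintype.piFinset_univ, sum_mul, mul_sum]
    rw [sum_comm]
    refine sum_congr rfl fun f _ => sum_congr rfl fun σ _ => ?_
    simp [prod_mul_distrib, mul_assoc]
  -- Permuting the columns of `A` costs a sign, so the sum over `τ` produces the second determinant.
  have h2 : ∀ τ : Equiv.Perm m, (A * B).det =
      ∑ f : m → n, (A.submatrix id f).det * (((Equiv.Perm.sign τ : ℤ) : R) *
        ∏ i, B (f (τ i)) i) := by
    intro τ
    rw [h1, ← (Equiv.arrowCongr τ.symm (Equiv.refl n)).sum_comp]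
    refine sum_congr rfl fun f _ => ?_
    have := det_permute' τ (A.submatrix id f)
    rw [submatrix_submatrix] at this
    rw [show (A.submatrix id ((Equiv.arrowCongr τ.symm (Equiv.refl n)) f)) =
      A.submatrix (id ∘ id) (f ∘ τ) from rfl, this]
    simp [mul_assoc, mul_left_comm]
  have h3 := sum_congr (rfl : (univ : Finset (Equiv.Perm m)) = univ) fun τ _ => h2 τ
  rw [sum_const, card_univ, Fintype.card_perm, nsmul_eq_mul] at h3
  rw [h3, sum_comm]
  refine sum_congr rfl fun f _ => ?_
  rw [← mul_sum, det_apply' (B.submatrix f id)]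
  rfl

end CauchyBinet

/-! ### Kalai's determinant -/

theorem sum_subtype_eq_sum {α M : Type*} [Fintype α] [AddCommMonoid M] {p : α → Prop}
    [Fintype {a // p a}] {f : α → M} (h : ∀ a, f a ≠ 0 → p a) :
    ∑ a : {a // p a}, f a = ∑ a, f a := by
  refine Fintype.sum_of_injective Subtype.val Subtype.val_injective _ _ ?_ fun _ => rfl
  intro a ha
  by_contra h'
  exact ha ⟨⟨a, h a h'⟩, rfl⟩

section ReducedBoundary

/-- All triangles with vertices in `ι`. -/
abbrev Triangle (ι : Type*) : Type _ := {t : Finset ι // t.card = 3}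

theorem card_triangle (ι : Type*) [Fintype ι] :
    Fintype.card (Triangle ι) = (Fintype.card ι).choose 3 := by
  rw [Fintype.card_of_subtype (powersetCard 3 univ), card_powersetCard, card_univ]
  intro e
  simp

variable {ι : Type*} [LinearOrder ι] [Fintype ι]

/-- The edges of the complete graph that avoid the vertex `o`. They are the edges outside the
spanning star at `o`, so they index coordinates on the `1`-cycles of the complete graph. -/
abbrev EdgeAvoiding (o : ι) : Type _ := {e : Finset ι // e.card = 2 ∧ o ∉ e}

/-- The boundary matrix from all triangles to edges, without the rows of the edges at `o`. -/
def reducedBoundary (R : Type*) [CommRing R] (o : ι) : Matrix (EdgeAvoiding o) (Triangle ι) R :=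
  fun e t => incidence R e.1 t.1

/-- The boundary matrix from the edges avoiding `o` to the vertices other than `o`. -/
def reducedVertexBoundary (R : Type*) [CommRing R] (o : ι) :
    Matrix {v : ι // v ≠ o} (EdgeAvoiding o) R :=
  fun v e => incidence R {v.1} e.1

theorem card_edgeAvoiding (o : ι) :
    Fintype.card (EdgeAvoiding o) = (Fintype.card ι - 1).choose 2 := by
  rw [Fintype.card_of_subtype (powersetCard 2 (univ.erase o)), card_powersetCard,
    card_erase_of_mem (mem_univ o), card_univ]
  intro e
  rw [mem_powersetCard, and_comm, subset_erase]
  simp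

/-- Deleting `o` loses no contribution to the down-Laplacian of edges that avoid `o`. -/
theorem reducedBoundary_mul_transpose (R : Type*) [CommRing R] (o : ι) :
    reducedBoundary R o * (reducedBoundary R o)ᵀ =
      scalar (EdgeAvoiding o) (Fintype.card ι : R) -
        (reducedVertexBoundary R o)ᵀ * reducedVertexBoundary R o := by
  ext e f
  have h := sum_incidence_add_sum_incidence R e.1 f.1
  have h1 : (reducedBoundary R o * (reducedBoundary R o)ᵀ) e f =
      ∑ t, incidence R e.1 t * incidence R f.1 t := by
    refine sum_subtype_eq_sum (p := fun t : Finset ι => t.card = 3)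
      (f := fun t => incidence R e.1 t * incidence R f.1 t) fun t ht => ?_
    rw [card_eq_of_incidence_ne_zero (left_ne_zero_of_mul ht), e.2.1]
  have h2 : ((reducedVertexBoundary R o)ᵀ * reducedVertexBoundary R o) e f =
      ∑ r, incidence R r e.1 * incidence R r f.1 := by
    refine Fintype.sum_of_injective (fun v : {v : ι // v ≠ o} => ({v.1} : Finset ι)) ?_ _ _ ?_
      fun _ => rfl
    · intro v w hvw
      exact Subtype.ext (singleton_injective hvw)
    · intro r hr
      by_contra h0
      have h0' := left_ne_zero_of_mul h0
      have hc := card_eq_of_incidence_ne_zero h0'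
      rw [e.2.1] at hc
      obtain ⟨v, rfl⟩ := card_eq_one.1 (by omega : r.card = 1)
      obtain ⟨w, -, hw⟩ := exists_erase_eq_of_incidence_ne_zero h0'
      refine hr ⟨⟨v, ?_⟩, rfl⟩
      rintro rfl
      exact e.2.2 (mem_of_mem_erase (hw ▸ mem_singleton_self v))
  rw [Matrix.sub_apply, h1, h2, eq_sub_iff_add_eq, h, scalar_apply, diagonal_apply]
  simp only [Subtype.ext_iff]

/-- The reduced graph Laplacian of the complete graph on the vertices other than `o`. -/
theorem reducedVertexBoundary_mul_transpose (R : Type*) [CommRing R] (o : ι) :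
    scalar {v : ι // v ≠ o} (Fintype.card ι : R) -
        reducedVertexBoundary R o * (reducedVertexBoundary R o)ᵀ =
      1 + (replicateCol Unit fun _ => 1 : Matrix _ Unit R) *
        (replicateRow Unit fun _ => 1 : Matrix Unit _ R) := by
  ext v w
  have h := sum_incidence_add_sum_incidence R {v.1} {w.1}
  have h1 : ∑ t, incidence R {v.1} t * incidence R {w.1} t =
      (reducedVertexBoundary R o * (reducedVertexBoundary R o)ᵀ) v w +
        if v = w then 1 else 0 := by
    have hs := sum_filter_add_sum_filter_not univ (fun t : Finset ι => o ∉ t)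
      fun t => incidence R {v.1} t * incidence R {w.1} t
    rw [← hs]
    -- The edges at `o` contribute only the edge `{v, o}`, and only if `v = w`.
    congr 1
    · rw [sum_filter, ← sum_subtype_eq_sum (p := fun e : Finset ι => e.card = 2 ∧ o ∉ e)]
      · exact sum_congr rfl fun e _ => if_pos e.2.2
      · intro t ht
        rw [ne_eq, ite_eq_right_iff, Classical.not_imp] at ht
        exact ⟨card_eq_of_incidence_ne_zero (left_ne_zero_of_mul ht.2), ht.1⟩
    · rw [sum_eq_single {v.1, o}]
      · split_ifs with hvw
        · rw [← hvw, incidence_singleton_pair_mul_self R v.2]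
        · rw [incidence_singleton_eq_zero_of_notMem R (v := w.1), mul_zero]
          simpa [w.2, Subtype.ext_iff, eq_comm] using hvw
      · intro t ht htv
        by_contra h0
        have h0' := left_ne_zero_of_mul h0
        have hv : v.1 ∈ t := by
          by_contra hv
          exact h0' (incidence_singleton_eq_zero_of_notMem R hv)
        have ho : o ∈ t := by simpa using ht
        refine htv (eq_of_subset_of_card_le ?_ ?_).symm
        · simp [insert_subset_iff, hv, ho]
        · rw [card_eq_of_incidence_ne_zero h0', card_pair v.2, card_singleton]
      · simp
  -- The down-Laplacian on vertices is the all-ones matrix, from the empty face.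
  have h2 : ∑ r, incidence R r {v.1} * incidence R r {w.1} = 1 := by
    simp_rw [mul_comm (incidence R _ {v.1})]
    rw [sum_mul_incidence, sum_singleton, erase_singleton]
    have := incidence_erase R (mem_singleton_self w.1)
    rw [erase_singleton] at this
    rw [this]
    simp [position, filter_singleton]
  rw [h1, h2] at h
  simp only [Matrix.sub_apply, scalar_apply, diagonal_apply, Matrix.add_apply, one_apply, mul_apply,
    replicateCol_apply, replicateRow_apply, Subtype.ext_iff, singleton_inj] at h ⊢
  simp at h ⊢
  linear_combination -h

/-- Kalai's determinant: the reduced up-Laplacian of the complete `2`-complex on `n` vertices has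
determinant `n ^ (m - n + 2)` with `m` the number of edges avoiding `o`. -/
theorem card_pow_mul_det_reducedBoundary (R : Type*) [CommRing R] (o : ι) :
    (Fintype.card ι : R) ^ (Fintype.card ι - 1) *
        (reducedBoundary R o * (reducedBoundary R o)ᵀ).det =
      (Fintype.card ι : R) ^ Fintype.card (EdgeAvoiding o) * Fintype.card ι := by
  have hV : Fintype.card {v : ι // v ≠ o} = Fintype.card ι - 1 := by
    simp [Fintype.card_subtype_compl]
  have hpos : 0 < Fintype.card ι := Fintype.card_pos_iff.2 ⟨o⟩
  have h := congrArg (Polynomial.eval (Fintype.card ι : R))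
    (charpoly_mul_comm' (reducedVertexBoundary R o)ᵀ (reducedVertexBoundary R o))
  simp only [Polynomial.eval_mul, Polynomial.eval_pow, Polynomial.eval_X, eval_charpoly] at h
  rw [reducedBoundary_mul_transpose, ← hV, h, reducedVertexBoundary_mul_transpose,
    det_one_add_replicateCol_mul_replicateRow]
  congr 1
  simp [dotProduct, hV, Nat.cast_sub (Nat.one_le_of_lt hpos)]

end ReducedBoundary

/-! ### Homology of complexes with complete `1`-skeleton -/

section CompleteSkeleton

/-- A sum over the `k`-faces of `K` containing all faces that contribute. -/
theorem sum_face_eq_sum {ι : Type*} [Fintype ι] {K : AbstractSimplicialComplex ι} {k : ℕ}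
    {M : Type*} [AddCommMonoid M] {f : Finset ι → M} (h : ∀ s, f s ≠ 0 → s ∈ K ∧ s.card = k + 1) :
    ∑ s : Face K k, f s.1 = ∑ s, f s := by
  refine Fintype.sum_of_injective (fun s : Face K k => s.1) (fun _ _ => Subtype.ext) _ _ ?_
    fun _ => rfl
  intro s hs
  by_contra h'
  exact hs ⟨⟨s, h s h'⟩, rfl⟩

theorem mem_of_card_eq_two {ι : Type*} [DecidableEq ι] {K : AbstractSimplicialComplex ι}
    (hK : ∀ u v : ι, u ≠ v → {u, v} ∈ K) {e : Finset ι} (he : e.card = 2) : e ∈ K := by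
  obtain ⟨u, v, huv, rfl⟩ := card_eq_two.1 he
  exact hK u v huv

variable {ι : Type*} [LinearOrder ι] [Fintype ι]

/-- The boundary matrix of `K` from triangles to edges, without the rows of the edges at `o`. -/
def reducedBoundaryOf (K : AbstractSimplicialComplex ι) (R : Type*) [CommRing R] (o : ι) :
    Matrix (EdgeAvoiding o) (Face K 2) R :=
  fun e t => incidence R e.1 t.1

theorem boundary_apply (K : AbstractSimplicialComplex ι) (R : Type*) [CommRing R] (k : ℕ)
    (x : Chain K R (k + 1)) (t : Face K k) :
    boundary K R k x t = ∑ s, incidence R t.1 s.1 * x s := rfl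

theorem boundary_boundary (K : AbstractSimplicialComplex ι) (R : Type*) [CommRing R] (k : ℕ)
    (x : Chain K R (k + 2)) : boundary K R k (boundary K R (k + 1) x) = 0 := by
  ext r
  simp only [boundary_apply, mul_sum, ← mul_assoc, Pi.zero_apply]
  rw [sum_comm]
  refine sum_eq_zero fun t _ => ?_
  rw [← sum_mul, sum_face_eq_sum (f := fun s => incidence R r.1 s * incidence R s t.1),
    sum_incidence_mul_incidence, zero_mul]
  intro s hs
  have hc := card_eq_of_incidence_ne_zero (left_ne_zero_of_mul hs)
  obtain ⟨v, -, hv⟩ := exists_erase_eq_of_incidence_ne_zero (right_ne_zero_of_mul hs)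
  refine ⟨(K.isRelLowerSet_faces t.2.1).2 (hv ▸ erase_subset _ _) (card_pos.1 (by omega)), ?_⟩
  rw [hc, r.2.2]

theorem boundaries_le_cycles (K : AbstractSimplicialComplex ι) (R : Type*) [CommRing R] :
    boundaries K R 1 ≤ cycles K R 1 := by
  rintro _ ⟨x, rfl⟩
  exact LinearMap.mem_ker.2 (boundary_boundary K R 0 x)

variable {K : AbstractSimplicialComplex ι}

/-- The edges avoiding `o` as faces of a complex with complete `1`-skeleton. -/
def edgeFace (hK : ∀ u v : ι, u ≠ v → {u, v} ∈ K)
    (o : ι) (e : EdgeAvoiding o) : Face K 1 :=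
  ⟨e.1, mem_of_card_eq_two hK e.2.1, e.2.1⟩

/-- Restriction of `1`-cycles to the edges avoiding `o`. -/
noncomputable def restrictCycles (hK : ∀ u v : ι, u ≠ v → {u, v} ∈ K)
    (R : Type*) [CommRing R] (o : ι) :
    cycles K R 1 →ₗ[R] (EdgeAvoiding o → R) :=
  (LinearMap.funLeft R R (edgeFace hK o)).comp (cycles K R 1).subtype

/-- A `1`-cycle supported on the star at `o` vanishes, as the star is a tree. -/
theorem restrictCycles_injective (hK : ∀ u v : ι, u ≠ v → {u, v} ∈ K)
    (R : Type*) [CommRing R] (o : ι) :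
    Function.Injective (restrictCycles hK R o) := by
  rw [← LinearMap.ker_eq_bot, LinearMap.ker_eq_bot']
  rintro ⟨z, hz⟩ h0
  have hoff : ∀ s : Face K 1, o ∉ s.1 → z s = 0 := fun s hs => congrFun h0 ⟨s.1, s.2.2, hs⟩
  refine Subtype.ext (funext fun s => ?_)
  by_cases ho : o ∈ s.1
  · obtain ⟨v, hv⟩ := card_eq_one.1 (by rw [card_erase_of_mem ho, s.2.2] : (s.1.erase o).card = 1)
    have hvo : v ≠ o := by
      rintro rfl
      exact notMem_erase v s.1 (hv ▸ mem_singleton_self v)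
    have hs : s.1 = {v, o} := by
      rw [← insert_erase ho, hv, pair_comm]
    let r : Face K 0 := ⟨{v}, K.singleton_mem v, card_singleton v⟩
    have hb : boundary K R 0 z r = 0 := congrFun (LinearMap.mem_ker.1 hz) r
    rw [boundary_apply, sum_eq_single s] at hb
    · have h1 := incidence_singleton_pair_mul_self R hvo
      rw [← hs] at h1
      calc z s = (incidence R {v} s.1 * incidence R {v} s.1) * z s := by rw [h1, one_mul]
        _ = 0 := by rw [mul_assoc, hb, mul_zero]
    · intro s' _ hs'
      by_cases ho' : o ∈ s'.1
      · rw [incidence_singleton_eq_zero_of_notMem, zero_mul]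
        intro hv'
        refine hs' (Subtype.ext ?_)
        rw [hs]
        refine (eq_of_subset_of_card_le ?_ ?_).symm
        · simp [insert_subset_iff, hv', ho']
        · rw [s'.2.2, card_pair hvo]
      · rw [hoff s' ho', mul_zero]
    · simp
  · exact hoff s ho

/-- Every chain on the edges avoiding `o` extends to a cycle, by the boundary of the cone with apex
`o`. -/
theorem restrictCycles_surjective (hK : ∀ u v : ι, u ≠ v → {u, v} ∈ K)
    (R : Type*) [CommRing R] (o : ι) :
    Function.Surjective (restrictCycles hK R o) := by
  intro y
  -- The cone `[o, e]` is weighted by the sign with which `e` occurs in its boundary.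
  let z : Chain K R 1 := fun s => ∑ e : EdgeAvoiding o,
    incidence R s.1 (insert o e.1) * ((-1) ^ position e.1 o * y e)
  have hz : z ∈ cycles K R 1 := by
    refine LinearMap.mem_ker.2 (funext fun r => ?_)
    simp only [boundary_apply, z, mul_sum, Pi.zero_apply]
    rw [sum_comm]
    refine sum_eq_zero fun e _ => ?_
    simp only [← mul_assoc, ← sum_mul]
    rw [sum_face_eq_sum (f := fun s => incidence R r.1 s * incidence R s (insert o e.1)),
      sum_incidence_mul_incidence, zero_mul, zero_mul]
    intro s hs
    have hc := card_eq_of_incidence_ne_zero (left_ne_zero_of_mul hs)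
    rw [r.2.2] at hc
    exact ⟨mem_of_card_eq_two hK hc, hc⟩
  refine ⟨⟨z, hz⟩, funext fun e => ?_⟩
  change ∑ e' : EdgeAvoiding o, incidence R e.1 (insert o e'.1) *
    ((-1) ^ position e'.1 o * y e') = y e
  rw [sum_eq_single e]
  · have h1 := incidence_erase R (mem_insert_self o e.1)
    rw [erase_insert e.2.2, position_insert_self] at h1
    rw [h1, ← mul_assoc, ← pow_add, Even.neg_one_pow ⟨_, rfl⟩, one_mul]
  · intro e' _ he'
    by_contra h0
    obtain ⟨v, -, hv⟩ := exists_erase_eq_of_incidence_ne_zero (left_ne_zero_of_mul h0)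
    have hvo : v = o := by
      by_contra hvo
      exact e.2.2 (hv ▸ mem_erase.2 ⟨Ne.symm hvo, mem_insert_self _ _⟩)
    subst hvo
    rw [erase_insert e'.2.2] at hv
    exact he' (Subtype.ext hv)
  · simp

/-- The `1`-cycles of a complex with complete `1`-skeleton are freely parametrized by their
coefficients at the edges avoiding `o`. -/
noncomputable def cyclesEquiv (hK : ∀ u v : ι, u ≠ v → {u, v} ∈ K)
    (R : Type*) [CommRing R] (o : ι) : cycles K R 1 ≃ₗ[R] (EdgeAvoiding o → R) :=
  LinearEquiv.ofBijective (restrictCycles hK R o)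
    ⟨restrictCycles_injective hK R o, restrictCycles_surjective hK R o⟩

theorem cyclesEquiv_boundary (hK : ∀ u v : ι, u ≠ v → {u, v} ∈ K)
    (R : Type*) [CommRing R] (o : ι) (x : Chain K R 2) :
    cyclesEquiv hK R o ⟨boundary K R 1 x, boundaries_le_cycles K R ⟨x, rfl⟩⟩ =
      (reducedBoundaryOf K R o) *ᵥ x := rfl

theorem map_cyclesEquiv_boundaries (hK : ∀ u v : ι, u ≠ v → {u, v} ∈ K)
    (R : Type*) [CommRing R] (o : ι) :
    ((boundaries K R 1).submoduleOf (cycles K R 1)).map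
      (cyclesEquiv hK R o : cycles K R 1 →ₗ[R] (EdgeAvoiding o → R)) =
      LinearMap.range (reducedBoundaryOf K R o).mulVecLin := by
  ext y
  constructor
  · rintro ⟨⟨_, _⟩, ⟨x, rfl⟩, rfl⟩
    exact ⟨x, rfl⟩
  · rintro ⟨x, rfl⟩
    exact ⟨⟨boundary K R 1 x, boundaries_le_cycles K R ⟨x, rfl⟩⟩, ⟨x, rfl⟩, rfl⟩

/-- The first homology is the cokernel of the reduced boundary matrix. -/
noncomputable def homologyOneEquiv (hK : ∀ u v : ι, u ≠ v → {u, v} ∈ K)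
    (R : Type*) [CommRing R] (o : ι) :
    Homology K R 1 ≃ₗ[R]
      (EdgeAvoiding o → R) ⧸ LinearMap.range (reducedBoundaryOf K R o).mulVecLin :=
  Submodule.Quotient.equiv _ _ (cyclesEquiv hK R o) (map_cyclesEquiv_boundaries hK R o)

theorem subsingleton_homology_one_iff (hK : ∀ u v : ι, u ≠ v → {u, v} ∈ K)
    (R : Type*) [CommRing R] (o : ι) :
    Subsingleton (Homology K R 1) ↔ Function.Surjective (reducedBoundaryOf K R o).mulVec := by
  rw [(homologyOneEquiv hK R o).toEquiv.subsingleton_congr, Submodule.Quotient.subsingleton_iff,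
    LinearMap.range_eq_top]
  rfl

theorem subsingleton_homology_two_iff (hK : ∀ u v : ι, u ≠ v → {u, v} ∈ K)
    (hcard : ∀ s ∈ K, s.card ≤ 3) (R : Type*) [CommRing R]
    (o : ι) :
    Subsingleton (Homology K R 2) ↔ Function.Injective (reducedBoundaryOf K R o).mulVec := by
  have hempty : IsEmpty (Face K 3) := ⟨fun s => by have := hcard s.1 s.2.1; have := s.2.2; omega⟩
  have hb : (boundaries K R 2).submoduleOf (cycles K R 2) = ⊥ := by
    rw [eq_bot_iff]
    rintro ⟨_, _⟩ ⟨x, rfl⟩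
    rw [Submodule.mem_bot, Subtype.ext_iff]
    change boundary K R 2 x = 0
    rw [Subsingleton.elim x 0, map_zero]
  have hker : Subsingleton (Homology K R 2) ↔ ∀ x, boundary K R 1 x = 0 → x = 0 := by
    rw [Submodule.Quotient.subsingleton_iff, hb, subsingleton_iff_bot_eq_top,
      Submodule.subsingleton_iff, Submodule.subsingleton_iff_eq_bot, eq_bot_iff]
    rfl
  have hinj : Function.Injective (reducedBoundaryOf K R o).mulVec ↔
      ∀ x, reducedBoundaryOf K R o *ᵥ x = 0 → x = 0 :=
    injective_iff_map_eq_zero (reducedBoundaryOf K R o).mulVecLin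
  rw [hker, hinj]
  refine forall_congr' fun x => imp_congr_left ?_
  rw [← cyclesEquiv_boundary hK, LinearEquiv.map_eq_zero_iff, Subtype.ext_iff]
  rfl

end CompleteSkeleton

/-! ### Two-trees and nonvanishing minors -/

section TwoTrees

theorem card_quotient_range_mulVecLin {m : Type*} [Fintype m] [DecidableEq m] (A : Matrix m m ℤ)
    (hA : A.det ≠ 0) :
    Nat.card ((m → ℤ) ⧸ LinearMap.range A.mulVecLin) = A.det.natAbs := by
  have hinj : Function.Injective A.mulVecLin := mulVec_injective_of_det_ne_zero hA
  have h := Submodule.natAbs_det_equiv _ (LinearEquiv.ofInjective A.mulVecLin hinj)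
  rw [← h, ← LinearMap.det_toLin' A]
  rfl

theorem range_mulVecLin_submatrix_equiv {m n l R : Type*} [Fintype n] [Fintype l] [CommRing R]
    (A : Matrix m n R) (g : l ≃ n) :
    LinearMap.range (A.submatrix id g).mulVecLin = LinearMap.range A.mulVecLin := by
  ext y
  constructor
  · rintro ⟨x, rfl⟩
    refine ⟨x ∘ g.symm, ?_⟩
    have := submatrix_mulVec_equiv A x id g
    simp only [mulVecLin_apply]
    rw [this]; rfl
  · rintro ⟨x, rfl⟩
    refine ⟨x ∘ g, ?_⟩
    have := submatrix_mulVec_equiv A (x ∘ g) id g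
    simp only [mulVecLin_apply]
    rw [this]
    simp [Function.comp_assoc]

variable {n : ℕ}

theorem _root_.IsTwoTree.bijective_mulVec {K : AbstractSimplicialComplex (Fin n)}
    (hK : IsTwoTree K) (o : Fin n) :
    Function.Bijective (reducedBoundaryOf K ℚ o).mulVec :=
  ⟨(subsingleton_homology_two_iff hK.complete hK.card_le ℚ o).1 hK.homology_two,
    (subsingleton_homology_one_iff hK.complete ℚ o).1 hK.homology_one⟩

/-- A `2`-tree has as many triangles as there are edges avoiding `o`, because its reduced boundary
matrix is invertible over `ℚ`. -/
theorem _root_.IsTwoTree.card_face_two {K : AbstractSimplicialComplex (Fin n)}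
    (hK : IsTwoTree K) (o : Fin n) :
    Fintype.card (EdgeAvoiding o) = Fintype.card (Face K 2) := by
  have := (LinearEquiv.ofBijective (reducedBoundaryOf K ℚ o).mulVecLin
    (hK.bijective_mulVec o)).finrank_eq
  simpa using this.symm

/-- A `2`-tree is determined by its triangles. -/
theorem _root_.IsTwoTree.le_of_triangles {K L : AbstractSimplicialComplex (Fin n)}
    (hK : IsTwoTree K) (hL : IsTwoTree L) (h : ∀ s ∈ K, s.card = 3 → s ∈ L) : K ≤ L := by
  intro s hs
  have hpos := card_pos.2 (K.isRelLowerSet_faces hs).1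
  have hle := hK.card_le s hs
  obtain h1 | h2 | h3 : s.card = 1 ∨ s.card = 2 ∨ s.card = 3 := by omega
  · obtain ⟨v, rfl⟩ := card_eq_one.1 h1
    exact L.singleton_mem v
  · exact mem_of_card_eq_two hL.complete h2
  · exact h s hs h3

/-- An enumeration of the triangles of a `2`-tree by the edges avoiding `o`. -/
noncomputable def triangleEquiv (o : Fin n) (T : TwoTree n) : EdgeAvoiding o ≃ Face T.1 2 :=
  Fintype.equivOfCardEq (T.2.card_face_two o)

/-- All enumerations of the triangles of all `2`-trees: the pair `(T, σ)` stands for the fixed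
enumeration of the triangles of `T`, permuted by `σ`. -/
noncomputable def triangleFamily (o : Fin n) (p : TwoTree n × Equiv.Perm (EdgeAvoiding o)) :
    EdgeAvoiding o → Triangle (Fin n) :=
  fun e => ⟨(triangleEquiv o p.1 (p.2 e)).1, (triangleEquiv o p.1 (p.2 e)).2.2⟩

theorem mem_of_triangleFamily_eq {o : Fin n} {p q : TwoTree n × Equiv.Perm (EdgeAvoiding o)}
    (h : triangleFamily o p = triangleFamily o q) : p.1.1 ≤ q.1.1 := by
  refine p.1.2.le_of_triangles q.1.2 fun s hs h3 => ?_
  have hs' := congrFun h (p.2.symm ((triangleEquiv o p.1).symm ⟨s, hs, h3⟩))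
  have hs'' := congrArg Subtype.val hs'
  simp only [triangleFamily, Equiv.apply_symm_apply] at hs''
  have hs0 := congrArg (fun t : Face p.1.1 2 => t.1)
    ((triangleEquiv o p.1).apply_symm_apply ⟨s, hs, h3⟩)
  rw [show s = _ from hs0.symm.trans hs'']
  exact (triangleEquiv o q.1 _).2.1

theorem triangleFamily_injective (o : Fin n) : Function.Injective (triangleFamily o) := by
  rintro ⟨T, σ⟩ ⟨S, τ⟩ h
  obtain rfl : T = S :=
    Subtype.ext (le_antisymm (mem_of_triangleFamily_eq h) (mem_of_triangleFamily_eq h.symm))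
  refine Prod.ext rfl (Equiv.ext fun e => ?_)
  have h' := congrArg Subtype.val (congrFun h e)
  exact (triangleEquiv o T).injective (Subtype.ext h')

/-- The order of `H₁` of a `2`-tree is the absolute value of its reduced boundary determinant. -/
theorem torsionOrder_eq_natAbs_det (o : Fin n) (T : TwoTree n) (g : EdgeAvoiding o ≃ Face T.1 2) :
    torsionOrder T = ((reducedBoundaryOf T.1 ℤ o).submatrix id g).det.natAbs := by
  have hdet : ((reducedBoundaryOf T.1 ℤ o).submatrix id g).det ≠ 0 := by
    have hmap : (Int.castRingHom ℚ).mapMatrix ((reducedBoundaryOf T.1 ℤ o).submatrix id g) =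
        (reducedBoundaryOf T.1 ℚ o).submatrix id g := by
      ext e f
      exact incidence_map (Int.castRingHom ℚ) _ _
    have hsurj : Function.Surjective ((reducedBoundaryOf T.1 ℚ o).submatrix id g).mulVec := by
      have : LinearMap.range (reducedBoundaryOf T.1 ℚ o).mulVecLin = ⊤ :=
        LinearMap.range_eq_top.2 (T.2.bijective_mulVec o).2
      rw [← range_mulVecLin_submatrix_equiv _ g] at this
      exact LinearMap.range_eq_top.1 this
    intro h0
    have hu := (isUnit_iff_isUnit_det _).1 (mulVec_surjective_iff_isUnit.1 hsurj)
    rw [← hmap, ← RingHom.map_det, h0, map_zero] at hu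
    exact not_isUnit_zero hu
  rw [torsionOrder, Nat.card_congr (homologyOneEquiv T.2.complete ℤ o).toEquiv,
    ← range_mulVecLin_submatrix_equiv _ g, card_quotient_range_mulVecLin _ hdet]

theorem det_triangleFamily_sq (o : Fin n) (p : TwoTree n × Equiv.Perm (EdgeAvoiding o)) :
    ((reducedBoundary ℤ o).submatrix id (triangleFamily o p)).det ^ 2 =
      (torsionOrder p.1 : ℤ) ^ 2 := by
  rw [torsionOrder_eq_natAbs_det o p.1 (p.2.trans (triangleEquiv o p.1)), Int.natAbs_sq]
  rfl

/-- The complex with complete `1`-skeleton whose other faces form a given set of triangles. -/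
def complexOfTriangles (F : Set (Triangle (Fin n))) : AbstractSimplicialComplex (Fin n) where
  faces := {s | s.Nonempty ∧ (s.card ≤ 2 ∨ ∃ t ∈ F, t.1 = s)}
  isRelLowerSet_faces := by
    rintro s ⟨hs, h⟩
    refine ⟨hs, fun t hts ht => ⟨ht, ?_⟩⟩
    rcases h with h | ⟨u, hu, rfl⟩
    · exact Or.inl ((card_le_card hts).trans h)
    · rcases eq_or_ne t u.1 with rfl | hne
      · exact Or.inr ⟨u, hu, rfl⟩
      · have := card_lt_card (hts.ssubset_of_ne hne)
        rw [u.2] at this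
        exact Or.inl (by omega)
  singleton_mem v := ⟨singleton_nonempty v, Or.inl (by simp)⟩

/-- An injective family of triangles enumerates the `2`-faces of the complex it spans. -/
noncomputable def faceTwoEquiv {α : Type*} {f : α → Triangle (Fin n)} (hf : Function.Injective f) :
    α ≃ Face (complexOfTriangles (Set.range f)) 2 :=
  Equiv.ofBijective
    (fun a =>
      ⟨(f a).1, ⟨card_pos.1 (by rw [(f a).2]; omega), Or.inr ⟨f a, ⟨a, rfl⟩, rfl⟩⟩, (f a).2⟩)
    ⟨fun _ _ h => hf (Subtype.ext (congrArg (fun s : Face _ 2 => s.1) h)), by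
      rintro ⟨s, ⟨_, h⟩, h3⟩
      rcases h with h | ⟨_, ⟨a, rfl⟩, rfl⟩
      · omega
      · exact ⟨a, rfl⟩⟩

/-- A family of triangles with nonzero reduced boundary determinant enumerates a `2`-tree. There has
to be an edge avoiding `o`, since otherwise the empty family would span no triangle. -/
theorem mem_range_triangleFamily {o : Fin n} [Nonempty (EdgeAvoiding o)]
    {f : EdgeAvoiding o → Triangle (Fin n)}
    (hdet : ((reducedBoundary ℤ o).submatrix id f).det ≠ 0) :
    f ∈ Set.range (triangleFamily o) := by
  have hf : Function.Injective f := by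
    intro a b hab
    by_contra hne
    exact hdet (det_zero_of_column_eq hne fun e => by simp [hab])
  let K := complexOfTriangles (Set.range f)
  let g : EdgeAvoiding o ≃ Face K 2 := faceTwoEquiv hf
  have hcard : ∀ s ∈ K, s.card ≤ 3 := by
    rintro s ⟨_, h | ⟨t, _, rfl⟩⟩
    · omega
    · exact t.2.le
  have hcomplete : ∀ u v : Fin n, u ≠ v → {u, v} ∈ K := fun u v _ =>
    ⟨⟨u, by simp⟩, Or.inl card_le_two⟩
  have hunit : IsUnit ((reducedBoundaryOf K ℚ o).submatrix id g) := by
    have hmap : (Int.castRingHom ℚ).mapMatrix ((reducedBoundary ℤ o).submatrix id f) =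
        (reducedBoundaryOf K ℚ o).submatrix id g := by
      ext e e'
      exact incidence_map (Int.castRingHom ℚ) _ _
    rw [isUnit_iff_isUnit_det, ← hmap, ← RingHom.map_det, isUnit_iff_ne_zero]
    simpa using hdet
  have hK : IsTwoTree K := by
    refine ⟨hcard, ?_, hcomplete, ?_, ?_⟩
    · let t := g (Classical.arbitrary _)
      exact ⟨t.1, t.2⟩
    · rw [subsingleton_homology_one_iff hcomplete ℚ o]
      have h : LinearMap.range ((reducedBoundaryOf K ℚ o).submatrix id g).mulVecLin = ⊤ :=
        LinearMap.range_eq_top.2 (mulVec_surjective_iff_isUnit.2 hunit)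
      rw [range_mulVecLin_submatrix_equiv _ g] at h
      exact LinearMap.range_eq_top.1 h
    · rw [subsingleton_homology_two_iff hcomplete hcard ℚ o]
      intro x y hxy
      have hx : ∀ z, (reducedBoundaryOf K ℚ o).submatrix id g *ᵥ (z ∘ g) =
          reducedBoundaryOf K ℚ o *ᵥ z := fun z => by
        rw [submatrix_mulVec_equiv]
        simp [Function.comp_assoc]
      have := mulVec_injective_iff_isUnit.2 hunit
        (a₁ := x ∘ g) (a₂ := y ∘ g) (by simp only [hx]; exact hxy)
      exact g.surjective.injective_comp_right this
  refine ⟨⟨⟨K, hK⟩, g.trans (triangleEquiv o ⟨K, hK⟩).symm⟩, funext fun e => Subtype.ext ?_⟩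
  simp only [triangleFamily, Equiv.trans_apply, Equiv.apply_symm_apply]
  rfl

instance : Finite (TwoTree n) := by
  have : Finite (AbstractSimplicialComplex (Fin n)) :=
    Finite.of_injective (fun K => (K : Set (Finset (Fin n)))) SetLike.coe_injective
  infer_instance

noncomputable instance : Fintype (TwoTree n) := Fintype.ofFinite _

/-- **Kalai's theorem**: `∑ |H₁(T)|²` is `n ^ (n - 2).choose 2`, where
`(n - 2).choose 2 + (n - 1) = (n - 1).choose 2 + 1`. -/
theorem card_pow_mul_sum_torsionOrder_sq (o : Fin n) [Nonempty (EdgeAvoiding o)] :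
    n ^ (n - 1) * ∑ T : TwoTree n, torsionOrder T ^ 2 = n ^ ((n - 1).choose 2) * n := by
  have h1 : ((Fintype.card (EdgeAvoiding o)).factorial : ℤ) *
      (reducedBoundary ℤ o * (reducedBoundary ℤ o)ᵀ).det =
        (Fintype.card (EdgeAvoiding o)).factorial * ∑ T : TwoTree n, (torsionOrder T : ℤ) ^ 2 := by
    have h : ∑ p : TwoTree n × Equiv.Perm (EdgeAvoiding o), (torsionOrder p.1 : ℤ) ^ 2 =
        ∑ f : EdgeAvoiding o → Triangle (Fin n),
          ((reducedBoundary ℤ o).submatrix id f).det ^ 2 := by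
      refine Fintype.sum_of_injective (triangleFamily o) (triangleFamily_injective o) _ _ ?_
        fun p => (det_triangleFamily_sq o p).symm
      intro f hf
      by_contra h0
      exact hf (mem_range_triangleFamily fun h => h0 (by rw [h]; rfl))
    rw [factorial_mul_det_mul, ← Fintype.card_perm, mul_sum]
    rw [Fintype.sum_prod_type] at h
    simp only [sum_const, nsmul_eq_mul, card_univ] at h
    rw [h]
    refine sum_congr rfl fun f _ => ?_
    rw [← transpose_submatrix, det_transpose, sq]
  have h2 := mul_left_cancel₀ (by exact_mod_cast Nat.factorial_ne_zero _) h1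
  have h3 := card_pow_mul_det_reducedBoundary ℤ o
  rw [h2, card_edgeAvoiding, Fintype.card_fin] at h3
  exact_mod_cast h3

/-- Every `2`-tree has `(n - 1).choose 2` triangles, so it arises from that many factorial families
of triangles. -/
theorem factorial_mul_card_twoTree_le (o : Fin n) :
    ((n - 1).choose 2).factorial * Fintype.card (TwoTree n) ≤
      (n.choose 3) ^ ((n - 1).choose 2) := by
  have h := Fintype.card_le_of_injective _ (triangleFamily_injective o)
  rw [Fintype.card_prod, Fintype.card_perm, Fintype.card_fun, card_triangle, card_edgeAvoiding,
    Fintype.card_fin, mul_comm] at h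
  exact h

end TwoTrees

/-! ### The determinantal measure -/

section Probability

variable {n : ℕ}

/-- Positivity of the total weight excludes the division `0 / 0`. -/
theorem real_determinantalMeasure (hpos : 0 < ∑ T : TwoTree n, torsionOrder T ^ 2)
    (A : Set (TwoTree n)) [DecidablePred (· ∈ A)] :
    (determinantalMeasure n).real A =
      (∑ T with T ∈ A, (torsionOrder T : ℝ) ^ 2) / ∑ T : TwoTree n, (torsionOrder T : ℝ) ^ 2 := by
  obtain ⟨N, hN⟩ : ∃ N, N = ∑ T : TwoTree n, torsionOrder T ^ 2 := ⟨_, rfl⟩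
  have hsum : ∑' S : TwoTree n, torsionWeight S = N := by
    rw [tsum_fintype, hN]
    push_cast
    rfl
  have hreal : ∑ T : TwoTree n, (torsionOrder T : ℝ) ^ 2 = N := by
    rw [hN]
    push_cast
    rfl
  have hterm : ∀ T : TwoTree n, torsionWeight T / N ≠ ∞ := fun T =>
    ENNReal.div_ne_top (by simp [torsionWeight]) (by exact_mod_cast (hN ▸ hpos).ne')
  rw [Measure.real, determinantalMeasure, Measure.sum_apply _ MeasurableSpace.measurableSet_top,
    tsum_fintype, hsum, hreal, sum_filter, sum_div, ENNReal.toReal_sum]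
  · refine sum_congr rfl fun T _ => ?_
    rw [Measure.smul_apply, Measure.dirac_apply' _ MeasurableSpace.measurableSet_top]
    by_cases hT : T ∈ A <;> simp [hT, torsionWeight]
  · intro T _
    rw [Measure.smul_apply, smul_eq_mul]
    exact ENNReal.mul_ne_top (hterm T) (measure_ne_top _ _)

/-- The `2`-trees without torsion have weight `1` each, so their probability is at most the ratio of
the number of `2`-trees to the total weight. -/
theorem one_sub_le_real_determinantalMeasure (hpos : 0 < ∑ T : TwoTree n, torsionOrder T ^ 2) :
    1 - (Fintype.card (TwoTree n) : ℝ) / ∑ T : TwoTree n, (torsionOrder T : ℝ) ^ 2 ≤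
      (determinantalMeasure n).real {T : TwoTree n | Nontrivial (Homology T.1 ℤ 1)} := by
  classical
  have hpos' : (0 : ℝ) < ∑ T : TwoTree n, (torsionOrder T : ℝ) ^ 2 := by exact_mod_cast hpos
  rw [real_determinantalMeasure hpos, le_div_iff₀ hpos', sub_mul, div_mul_cancel₀ _ hpos'.ne',
    one_mul, sub_le_iff_le_add,
    ← sum_filter_add_sum_filter_not univ (· ∈ {T : TwoTree n | Nontrivial (Homology T.1 ℤ 1)})]
  gcongr
  rw [← card_univ, ← nsmul_one, ← sum_const]
  refine (sum_le_sum fun T hT => ?_).trans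
    (sum_le_sum_of_subset_of_nonneg (filter_subset _ _) fun _ _ _ => zero_le_one)
  have hT' : Subsingleton (Homology T.1 ℤ 1) :=
    not_nontrivial_iff_subsingleton.1 (mem_filter.1 hT).2
  rw [torsionOrder, Nat.card_of_subsingleton 0]
  norm_num

end Probability

/-! ### Asymptotics -/

section Asymptotics

open Real Filter

/-- `C(n, 3) ^ m / m! ≤ (e n / 3) ^ m` for `m = C(n - 1, 2)`. -/
theorem choose_three_pow_le {n : ℕ} (hn : 3 ≤ n) :
    ((n.choose 3 : ℕ) : ℝ) ^ ((n - 1).choose 2) ≤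
      ((n - 1).choose 2).factorial * (exp 1 * n / 3) ^ ((n - 1).choose 2) := by
  set m := (n - 1).choose 2 with hm
  have hchoose : ((n.choose 3 : ℕ) : ℝ) = m * (n / 3) := by
    have := Nat.add_one_mul_choose_eq (n - 1) 2
    rw [Nat.sub_add_cancel (by omega : 1 ≤ n)] at this
    have h : (n : ℝ) * m = n.choose 3 * 3 := by exact_mod_cast this
    linarith
  have hfac : (m : ℝ) ^ m ≤ m.factorial * exp 1 ^ m := by
    have := pow_div_factorial_le_exp (m : ℝ) (Nat.cast_nonneg m) m
    rw [div_le_iff₀ (by exact_mod_cast m.factorial_pos)] at this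
    rw [← exp_nat_mul, mul_one, mul_comm]
    exact this
  rw [hchoose, mul_pow, mul_div_assoc, mul_pow, ← mul_assoc]
  gcongr

/-- The total weight is positive, and the number of `2`-trees is small in comparison. -/
theorem card_twoTree_div_le {n : ℕ} (hn : 3 ≤ n) :
    0 < ∑ T : TwoTree n, torsionOrder T ^ 2 ∧
    (Fintype.card (TwoTree n) : ℝ) / ∑ T : TwoTree n, (torsionOrder T : ℝ) ^ 2 ≤
      (exp 1 / 3) ^ ((n - 1).choose 2) * n ^ (n - 2) := by
  let o : Fin n := ⟨0, by omega⟩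
  have hn0 : (0 : ℝ) < n := by exact_mod_cast (by omega : 0 < n)
  have hE : Nonempty (EdgeAvoiding o) := by
    rw [← Fintype.card_pos_iff, card_edgeAvoiding, Fintype.card_fin]
    exact Nat.choose_pos (by omega)
  have hkalai := card_pow_mul_sum_torsionOrder_sq o
  have hpos : 0 < ∑ T : TwoTree n, torsionOrder T ^ 2 := by
    refine Nat.pos_of_ne_zero fun h0 => ?_
    rw [h0, mul_zero] at hkalai
    exact absurd hkalai (by positivity)
  refine ⟨hpos, ?_⟩
  have hpos' : (0 : ℝ) < ∑ T : TwoTree n, (torsionOrder T : ℝ) ^ 2 := by exact_mod_cast hpos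
  have hcount : (((n - 1).choose 2).factorial : ℝ) * Fintype.card (TwoTree n) ≤
      (n.choose 3 : ℝ) ^ ((n - 1).choose 2) := by
    exact_mod_cast factorial_mul_card_twoTree_le o
  have hcard : (Fintype.card (TwoTree n) : ℝ) ≤ (exp 1 * n / 3) ^ ((n - 1).choose 2) :=
    le_of_mul_le_mul_left (hcount.trans (choose_three_pow_le hn))
      (by exact_mod_cast Nat.factorial_pos _)
  have hk : (n : ℝ) ^ (n - 2) * ∑ T : TwoTree n, (torsionOrder T : ℝ) ^ 2 =
      n ^ ((n - 1).choose 2) := by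
    have h : (n : ℝ) ^ (n - 1) * ∑ T : TwoTree n, (torsionOrder T : ℝ) ^ 2 =
        n ^ ((n - 1).choose 2) * n := by exact_mod_cast hkalai
    rw [show n - 1 = n - 2 + 1 by omega, pow_succ] at h
    refine mul_right_cancel₀ hn0.ne' ?_
    rw [show n - 1 = n - 2 + 1 by omega, ← h]
    ring
  rw [div_le_iff₀ hpos', mul_assoc, hk, ← mul_pow]
  rw [div_mul_eq_mul_div]
  exact hcard

/-- As `e < 3`, the factor `(e / 3) ^ C(n - 1, 2)` dominates `n ^ (n - 2)`. -/
theorem exists_eventually_le_exp_neg_sq :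
    ∃ c : ℝ, 0 < c ∧ ∀ᶠ n : ℕ in atTop,
      (exp 1 / 3) ^ ((n - 1).choose 2) * (n : ℝ) ^ (n - 2) ≤ exp (-(c * (n : ℝ) ^ 2)) := by
  set d := log 3 - 1 with hd
  have hdpos : 0 < d := by
    have := (lt_log_iff_exp_lt (by norm_num : (0 : ℝ) < 3)).2 exp_one_lt_three
    linarith
  refine ⟨d / 8, by positivity, ?_⟩
  have hlog : ∀ᶠ n : ℕ in atTop, log n ≤ d / 8 * n := by
    have := (isLittleO_log_id_atTop.comp_tendsto tendsto_natCast_atTop_atTop).bound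
      (by positivity : 0 < d / 8)
    filter_upwards [this] with n hn
    simpa using (le_abs_self _).trans hn
  filter_upwards [hlog, eventually_ge_atTop 6] with n hn h6
  have hn0 : (0 : ℝ) < n := by exact_mod_cast (by omega : 0 < n)
  have h6' : (6 : ℝ) ≤ n := by exact_mod_cast h6
  have hm : (n : ℝ) ^ 2 / 4 ≤ ((n - 1).choose 2 : ℕ) := by
    rw [Nat.cast_choose_two, Nat.cast_sub (by omega)]
    push_cast
    nlinarith
  have h1 : exp 1 / 3 = exp (-d) := by
    rw [hd, neg_sub, exp_sub, exp_log (by norm_num)]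
  rw [h1, ← exp_nat_mul, ← exp_log hn0, ← exp_nat_mul, ← exp_add, exp_log hn0]
  refine exp_le_exp.2 ?_
  -- The bounds combine to `-d * n² / 4 + d * n² / 8 = -d * n² / 8`.
  have h2 : ((n - 2 : ℕ) : ℝ) * log n ≤ n * (d / 8 * n) :=
    mul_le_mul (by exact_mod_cast Nat.sub_le n 2) hn (log_nonneg (by linarith)) hn0.le
  nlinarith [mul_le_mul_of_nonneg_right hm hdpos.le]

end Asymptotics

end SimplicialHomology

theorem theorem4p2 :
    ∃ c : ℝ, 0 < c ∧ ∀ᶠ n : ℕ in Filter.atTop,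
      1 - Real.exp (-(c * (n : ℝ) ^ 2)) ≤
        (determinantalMeasure n).real {T : TwoTree n | Nontrivial (SimplicialHomology.Homology T.1 ℤ 1)} := by
  obtain ⟨c, hc, h⟩ := SimplicialHomology.exists_eventually_le_exp_neg_sq
  refine ⟨c, hc, ?_⟩
  filter_upwards [h, Filter.eventually_ge_atTop 3] with n hn h3
  obtain ⟨hpos, hle⟩ := SimplicialHomology.card_twoTree_div_le h3
  exact (sub_le_sub_left (hle.trans hn) 1).trans
    (SimplicialHomology.one_sub_le_real_determinantalMeasure hpos)
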